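/- Let $n\ge 2$ and let $f$ be a probability density on $\mathbb R$ that is symmetric about $0$ and unimodal (nondecreasing on $(-\infty,0)$, nonincreasing on $(0,\infty)$). For every $\mu\in\mathbb R$ let $X_1,\dots,X_n$ be, under $\Pr_\mu$, i.i.d. random variables with density $x\mapsto f(x-\mu)$, so that $X_1$ has a symmetric unimodal distribution about $\mu$; assume $\mathrm E_\mu X_1^2<\infty$ and put $\sigma^2=\mathrm{var}(X_1)$ with $\sigma>0$ (it does not depend on $\mu$) and $\bar X_n=\frac1n\sum_{i=1}^n X_i$. Consider testing $H_0:\mu=0$ against $H_1:\mu>0$. Suppose that $\bar X_n$ is a complete statistic under $H_0$ or under $H_1$; that is, for $\Theta=\{0\}$ or for $\Theta=(0,\infty)$: whenever $g:\mathbb R\to\mathbb R$ is measurable and, for all $\mu\in\Theta$, $g(\bar X_n)$ is $\Pr_\mu$-integrable with $\mathrm E_\mu g(\bar X_n)=0$, then $g(\bar X_n)=0$ $\Pr_\mu$-almost surely for all $\mu\in\Theta$. Then $X_1$ is normally distributed (under every $\Pr_\mu$) if and only if $T=\sqrt n\,\bar X_n/\sigma$ is the most powerful (MP) test statistic for the location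 parameter, in the following sense: for every alternative $\mu>0$, every threshold $C\in\mathbb R$ and every measurable test function $\varphi:\mathbb R^n\to[0,1]$ with $\mathrm E_0\,\varphi(X_1,\dots,X_n)\le \Pr_0(T>C)$, one has $\mathrm E_\mu\,\varphi(X_1,\dots,X_n)\le \Pr_\mu(T>C)$. -/

import Mathlib

open MeasureTheory ProbabilityTheory
open scoped NNReal ENNReal

/-- `f` is (a version of) a probability density on `ℝ` without the normalisation, which is
symmetric about `m` and unimodal with mode `m`: it is nondecreasing to the left of `m` and
nonincreasing to the right of `m`. No condition is put on the single value `f m`, so that densities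
which are unbounded near the mode are included. -/
structure IsSymmetricUnimodalDensity (f : ℝ → ℝ) (m : ℝ) : Prop where
  measurable : Measurable f
  nonneg : ∀ x, 0 ≤ f x
  symmetric : ∀ u, f (m + u) = f (m - u)
  monotoneOn : MonotoneOn f (Set.Iio m)
  antitoneOn : AntitoneOn f (Set.Ioi m)

/-- The sample mean of `X 0, …, X (n - 1)`. -/
noncomputable def sampleMean {Ω : Type*} {n : ℕ} (X : Fin n → Ω → ℝ) (ω : Ω) : ℝ :=
  (∑ i, X i ω) / n

/-- The real statistic `T` is complete for the family `(P θ)`, `θ ∈ S`: a measurable function `g`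
with `E_θ g(T) = 0` (the expectation being finite) for every `θ ∈ S` satisfies `g(T) = 0` almost
surely under every `P θ`, `θ ∈ S`. -/
def IsCompleteStatistic {Ω Θ : Type*} [MeasurableSpace Ω] (P : Θ → Measure Ω) (S : Set Θ)
    (T : Ω → ℝ) : Prop :=
  ∀ g : ℝ → ℝ, Measurable g →
    (∀ θ ∈ S, Integrable (fun ω => g (T ω)) (P θ) ∧ ∫ ω, g (T ω) ∂(P θ) = 0) →
    ∀ θ ∈ S, ∀ᵐ ω ∂(P θ), g (T ω) = 0

/-- The statistic `T` is most powerful, on the basis of the data `D`, for testing the null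
distribution `P₀` against the alternative `P₁`, the hypothesis being rejected for large values of
`T`: for every threshold `C`, no (possibly randomized) test `φ(D)` whose type I error
probability is at most that of the test `T > C` has greater power than the test `T > C`. -/
def IsMostPowerful {Ω 𝕏 : Type*} [MeasurableSpace Ω] [MeasurableSpace 𝕏] (P₀ P₁ : Measure Ω)
    (D : Ω → 𝕏) (T : Ω → ℝ) : Prop :=
  ∀ C : ℝ, ∀ φ : 𝕏 → ℝ, Measurable φ → (∀ x, 0 ≤ φ x ∧ φ x ≤ 1) →
    ∫ ω, φ (D ω) ∂P₀ ≤ P₀.real {ω | C < T ω} →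
    ∫ ω, φ (D ω) ∂P₁ ≤ P₁.real {ω | C < T ω}

/-!
The statistic is a strictly increasing function of the sum `S` of the observations, so everything is
about how the likelihood ratio `∏ f(xᵢ - μ) / ∏ f(xᵢ)` depends on `S`.

If the law is Gaussian, that ratio is the exponential of an increasing affine function of `S`, and
the Neyman–Pearson lemma (`integral_le_of_likelihoodRatio_threshold`) shows that `T` is most powerful
(`isMostPowerful_of_gaussian`).

Conversely, let `T` be most powerful against every `μ > 0`. Comparing the tests `T > C` with tests
which exchange a small box inside the rejection region for a small box outside it shows that the
ratio is nondecreasing in `S` at all points whose coordinates avoid the countably many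
discontinuities of `f` (`prod_density_mul_le`); a comparison with a test of size zero shows that `f`
vanishes nowhere off `0` (`density_pos_of_isMostPowerful`). By continuity the ratio depends on `S`
only, so that, with `ψ = log f`, the sum
`(ψ(s - μ) - ψ(s)) + (ψ(t - μ) - ψ(t))` is a nondecreasing function of `s + t`. This forces the
mixed second differences of `ψ` to be additive in each increment, and since `ψ` is even it is a
quadratic polynomial off a countable set (`exists_quadratic_of_increments`). A probability density of
this form is Gaussian (`gaussian_of_quadratic_log`).
-/

/-! ### Gaussian samples and the Neyman–Pearson lemma -/

/-- Sufficiency in the Neyman–Pearson lemma: a test whose rejection region `A` separates large from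
small values of the likelihood ratio `L` has at least the power of any test whose size does not
exceed the size of `A`. -/
theorem integral_le_of_likelihoodRatio_threshold {𝕏 : Type*} [MeasurableSpace 𝕏]
    {Q₀ Q₁ : Measure 𝕏} [IsFiniteMeasure Q₀] [IsFiniteMeasure Q₁] {L : 𝕏 → ℝ}
    (hLm : Measurable L) (hL0 : ∀ x, 0 ≤ L x)
    (hQ : Q₁ = Q₀.withDensity fun x => ENNReal.ofReal (L x)) {A : Set 𝕏} (hA : MeasurableSet A)
    {k : ℝ} (hk : 0 ≤ k) (hin : ∀ x ∈ A, k ≤ L x) (hout : ∀ x ∉ A, L x ≤ k)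
    {φ : 𝕏 → ℝ} (hφ : Measurable φ) (hφ01 : ∀ x, 0 ≤ φ x ∧ φ x ≤ 1)
    (hsize : ∫ x, φ x ∂Q₀ ≤ Q₀.real A) : ∫ x, φ x ∂Q₁ ≤ Q₁.real A := by
  have hint : ∀ (Q : Measure 𝕏) [IsFiniteMeasure Q], Integrable φ Q := fun Q _ =>
    Integrable.of_bound hφ.aestronglyMeasurable 1
      (Filter.Eventually.of_forall fun x => by
        rw [Real.norm_eq_abs, abs_of_nonneg (hφ01 x).1]; exact (hφ01 x).2)
  have hind : ∀ (Q : Measure 𝕏) [IsFiniteMeasure Q],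
      Integrable (A.indicator fun _ => (1 : ℝ)) Q := fun Q _ =>
    (integrable_const (1 : ℝ)).indicator hA
  -- `(L - k) * d` is nonnegative everywhere
  set d : 𝕏 → ℝ := fun x => A.indicator (fun _ => (1 : ℝ)) x - φ x with hd
  have hdint : ∀ (Q : Measure 𝕏) [IsFiniteMeasure Q], Integrable d Q := fun Q _ =>
    (hind Q).sub (hint Q)
  have hdiff : ∀ (Q : Measure 𝕏) [IsFiniteMeasure Q],
      ∫ x, d x ∂Q = Q.real A - ∫ x, φ x ∂Q := by
    intro Q _
    rw [hd, integral_sub (hind Q) (hint Q), integral_indicator_const (1 : ℝ) hA]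
    simp
  have hdens : ∫ x, d x ∂Q₁ = ∫ x, L x * d x ∂Q₀ := by
    rw [hQ, integral_withDensity_eq_integral_toReal_smul (by fun_prop) (by simp)]
    simp [ENNReal.toReal_ofReal (hL0 _)]
  have hLd : Integrable (fun x => L x * d x) Q₀ := by
    have h := hdint Q₁
    rw [hQ, integrable_withDensity_iff_integrable_smul' (by fun_prop) (by simp)] at h
    simpa [ENNReal.toReal_ofReal (hL0 _)] using h
  have hmono : ∫ x, k * d x ∂Q₀ ≤ ∫ x, L x * d x ∂Q₀ := by
    refine integral_mono ((hdint Q₀).const_mul k) hLd fun x => ?_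
    by_cases hx : x ∈ A
    · have : 0 ≤ d x := by simp [hd, hx, (hφ01 x).2]
      exact mul_le_mul_of_nonneg_right (hin x hx) this
    · have : d x ≤ 0 := by simp [hd, hx, (hφ01 x).1]
      exact mul_le_mul_of_nonpos_right (hout x hx) this
  rw [integral_const_mul, ← hdens, hdiff, hdiff] at hmono
  nlinarith [mul_nonneg hk (sub_nonneg.2 hsize)]

theorem pi_eq_withDensity_prod {ι : Type*} [Fintype ι] {α : ι → Type*}
    [∀ i, MeasurableSpace (α i)] (μ ν : ∀ i, Measure (α i)) [∀ i, IsProbabilityMeasure (μ i)]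
    [∀ i, SigmaFinite (ν i)] (g : ∀ i, α i → ℝ≥0∞) (hg : ∀ i, Measurable (g i))
    (hν : ∀ i, ν i = (μ i).withDensity (g i)) :
    Measure.pi ν = (Measure.pi μ).withDensity fun x => ∏ i, g i (x i) := by
  refine Measure.pi_eq fun s hs => ?_
  rw [withDensity_apply _ (MeasurableSet.univ_pi hs),
    ← lintegral_indicator (MeasurableSet.univ_pi hs)]
  have hprod : ∀ x : ∀ i, α i, (Set.univ.pi s).indicator (fun x => ∏ i, g i (x i)) x
      = ∏ i, (s i).indicator (g i) (x i) := by
    intro x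
    by_cases hx : ∀ i, x i ∈ s i
    · rw [Set.indicator_of_mem (by simpa using hx)]
      exact Finset.prod_congr rfl fun i _ => (Set.indicator_of_mem (hx i) _).symm
    · rw [Set.indicator_of_notMem (by simpa using hx)]
      obtain ⟨i, hi⟩ := not_forall.1 hx
      exact (Finset.prod_eq_zero (Finset.mem_univ i) (Set.indicator_of_notMem hi _)).symm
  simp_rw [hprod]
  have hind := iIndepFun_pi (μ := μ) (X := fun i => (s i).indicator (g i))
    fun i => ((hg i).indicator (hs i)).aemeasurable
  rw [lintegral_prod_eq_prod_lintegral_of_indepFun Finset.univ _ hind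
    fun i => ((hg i).indicator (hs i)).comp (measurable_pi_apply i)]
  refine Finset.prod_congr rfl fun i _ => ?_
  rw [hν i, withDensity_apply _ (hs i), ← lintegral_indicator (hs i)]
  exact (measurePreserving_eval μ i).lintegral_comp ((hg i).indicator (hs i))

theorem gaussianReal_eq_withDensity_exp (m μ : ℝ) {v : ℝ≥0} (hv : v ≠ 0) :
    gaussianReal (m + μ) v = (gaussianReal m v).withDensity
      fun x => ENNReal.ofReal (Real.exp ((2 * μ * (x - m) - μ ^ 2) / (2 * v))) := by
  rw [gaussianReal_of_var_ne_zero _ hv, gaussianReal_of_var_ne_zero _ hv,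
    ← withDensity_mul _ (by fun_prop) (by fun_prop)]
  congr 1
  funext x
  rw [Pi.mul_apply, gaussianPDF, gaussianPDF, ← ENNReal.ofReal_mul (gaussianPDFReal_nonneg _ _ _),
    gaussianPDFReal, gaussianPDFReal, mul_assoc (√(2 * Real.pi * v))⁻¹, ← Real.exp_add]
  congr 3
  have : (v : ℝ) ≠ 0 := by exact_mod_cast hv
  field_simp
  ring

theorem map_add_withDensity_ofReal (f : ℝ → ℝ) (a μ : ℝ) :
    (volume.withDensity fun x => ENNReal.ofReal (f (x - a))).map (· + μ)
      = volume.withDensity fun x => ENNReal.ofReal (f (x - (a + μ))) := by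
  ext s hs
  rw [Measure.map_apply (by fun_prop) hs, withDensity_apply _ (by measurability),
    withDensity_apply _ hs, ← lintegral_indicator hs, ← lintegral_indicator (by measurability)]
  conv_rhs => rw [← lintegral_add_right_eq_self _ μ]
  congr 1
  funext x
  have hx : x + μ - (a + μ) = x - a := by ring
  simp only [Set.indicator, hx]
  rfl

theorem lt_standardized_iff {n : ℕ} (hn : 0 < n) {σ : ℝ} (hσ : 0 < σ) {C S : ℝ} :
    C < Real.sqrt n * (S / n) / σ ↔ C * σ * Real.sqrt n < S := by
  have hnpos : (0 : ℝ) < n := by exact_mod_cast hn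
  have hs : 0 < Real.sqrt n := Real.sqrt_pos.2 hnpos
  have h : Real.sqrt n * (S / n) / σ = S / (σ * Real.sqrt n) := by
    nth_rw 2 [← Real.mul_self_sqrt hnpos.le]
    field_simp
  rw [h, lt_div_iff₀ (mul_pos hσ hs), mul_assoc]

/-- For two Gaussian samples which differ by a positive shift `μ`, the likelihood ratio is an
increasing function of the sum of the observations, so the standardized mean is most powerful. -/
theorem isMostPowerful_of_gaussian {Ω : Type*} [MeasurableSpace Ω] {P₀ P₁ : Measure Ω}
    [IsProbabilityMeasure P₀] [IsProbabilityMeasure P₁] {n : ℕ} (hn : 0 < n)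
    {X : Fin n → Ω → ℝ} (hX : ∀ i, Measurable (X i)) (h₀ : iIndepFun X P₀) (h₁ : iIndepFun X P₁)
    {m μ : ℝ} {v : ℝ≥0} (hv : v ≠ 0) (hμ : 0 < μ)
    (hlaw₀ : ∀ i, P₀.map (X i) = gaussianReal m v)
    (hlaw₁ : ∀ i, P₁.map (X i) = gaussianReal (m + μ) v) {σ : ℝ} (hσ : 0 < σ) :
    IsMostPowerful P₀ P₁ (fun ω i => X i ω) (fun ω => Real.sqrt n * sampleMean X ω / σ) := by
  intro C φ hφ hφ01 hsize
  have hD : Measurable (fun ω i => X i ω) := measurable_pi_lambda _ hX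
  set A : Set (Fin n → ℝ) := {x | C < Real.sqrt n * ((∑ i, x i) / n) / σ} with hAdef
  have hA : MeasurableSet A := measurableSet_lt (by fun_prop) (by fun_prop)
  have hmap₀ : P₀.map (fun ω i => X i ω) = Measure.pi fun _ => gaussianReal m v := by
    rw [(iIndepFun_iff_map_fun_eq_pi_map fun i => (hX i).aemeasurable).1 h₀]
    simp_rw [hlaw₀]
  have hmap₁ : P₁.map (fun ω i => X i ω) = Measure.pi fun _ => gaussianReal (m + μ) v := by
    rw [(iIndepFun_iff_map_fun_eq_pi_map fun i => (hX i).aemeasurable).1 h₁]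
    simp_rw [hlaw₁]
  have hreal : ∀ P : Measure Ω, P.real {ω | C < Real.sqrt n * sampleMean X ω / σ}
      = (P.map fun ω i => X i ω).real A := by
    intro P
    rw [map_measureReal_apply hD hA]
    rfl
  have hpow : ∀ P : Measure Ω, ∫ ω, φ (fun i => X i ω) ∂P
      = ∫ x, φ x ∂(P.map fun ω i => X i ω) := fun P =>
    (integral_map hD.aemeasurable hφ.aestronglyMeasurable).symm
  rw [hreal, hpow, hmap₀] at hsize
  rw [hreal, hpow, hmap₁]
  set L : ℝ → ℝ := fun t => Real.exp ((2 * μ * (t - n * m) - n * μ ^ 2) / (2 * v)) with hL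
  have hvpos : (0 : ℝ) < v := by exact_mod_cast pos_iff_ne_zero.2 hv
  have hLmono : Monotone L := by
    intro s t hst
    refine Real.exp_le_exp.2 ?_
    gcongr
  have hnpos : (0 : ℝ) < n := by exact_mod_cast hn
  -- the threshold for the sum which corresponds to the threshold `C` for the statistic
  have hthr : ∀ x : Fin n → ℝ, x ∈ A ↔ C * σ * Real.sqrt n < ∑ i, x i :=
    fun x => lt_standardized_iff hn hσ
  refine integral_le_of_likelihoodRatio_threshold (Q₀ := Measure.pi fun _ => gaussianReal m v)
    (L := fun x => L (∑ i, x i)) (k := L (C * σ * Real.sqrt n)) (by fun_prop)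
    (fun x => (Real.exp_pos _).le) ?_ hA (Real.exp_pos _).le
    (fun x hx => hLmono ((hthr x).1 hx).le)
    (fun x hx => hLmono (not_lt.1 fun h => hx ((hthr x).2 h))) hφ hφ01 hsize
  rw [pi_eq_withDensity_prod (fun _ => gaussianReal m v) (fun _ => gaussianReal (m + μ) v)
    (fun _ x => ENNReal.ofReal (Real.exp ((2 * μ * (x - m) - μ ^ 2) / (2 * v))))
    (fun _ => by fun_prop) (fun _ => gaussianReal_eq_withDensity_exp m μ hv)]
  congr 1
  funext x
  rw [← ENNReal.ofReal_prod_of_nonneg fun i _ => (Real.exp_pos _).le, ← Real.exp_sum,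
    ← Finset.sum_div]
  congr 3
  simp [Finset.sum_sub_distrib, ← Finset.mul_sum]

/-! ### A functional equation for even functions -/

/-- Generic base points: finitely many translates of a point can avoid a given countable set
simultaneously. -/
theorem Set.Countable.exists_forall_add_notMem {D : Set ℝ} (hD : D.Countable) (F : Finset ℝ) :
    ∃ s, ∀ a ∈ F, s + a ∉ D := by
  have hc : (⋃ a ∈ F, (fun s => s + a) ⁻¹' D).Countable :=
    F.countable_toSet.biUnion fun a _ => hD.preimage (add_left_injective a)
  obtain ⟨s, hs⟩ := (hc.dense_compl ℝ).nonempty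
  exact ⟨s, fun a ha h => hs (Set.mem_biUnion ha h)⟩

theorem eq_mul_of_additive_of_nonneg {a : ℝ → ℝ} (hadd : ∀ h k, a (h + k) = a h + a k)
    (hnn : ∀ h, 0 ≤ h → 0 ≤ a h) (h : ℝ) : a h = a 1 * h := by
  have hmono : Monotone a := by
    intro x y hxy
    have h1 := hadd x (y - x)
    have h2 := hnn (y - x) (by linarith)
    rw [add_sub_cancel] at h1
    linarith
  let A : ℝ →+ ℝ := AddMonoidHom.mk' a hadd
  have hrat : ∀ q : ℚ, a q = a 1 * q := by
    intro q
    have := map_rat_smul A q (1 : ℝ)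
    simp only [A, AddMonoidHom.mk'_apply, Rat.smul_def, mul_one] at this
    rw [this, mul_comm]
  have hpos : 0 ≤ a 1 := hnn 1 zero_le_one
  refine le_antisymm (le_of_forall_pos_lt_add fun ε hε => ?_)
    (le_of_forall_pos_lt_add fun ε hε => ?_)
  · obtain ⟨q, hq1, hq2⟩ := exists_rat_btwn (show h < h + ε / (a 1 + 1) by
      have : 0 < ε / (a 1 + 1) := by positivity
      linarith)
    have h1 := hmono hq1.le
    rw [hrat] at h1
    have h2 : a 1 * q ≤ a 1 * (h + ε / (a 1 + 1)) := by gcongr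
    have h3 : a 1 * (ε / (a 1 + 1)) < ε := by
      rw [← mul_div_assoc, div_lt_iff₀ (by positivity)]
      nlinarith
    linarith
  · obtain ⟨q, hq1, hq2⟩ := exists_rat_btwn (show h - ε / (a 1 + 1) < h by
      have : 0 < ε / (a 1 + 1) := by positivity
      linarith)
    have h1 := hmono hq2.le
    rw [hrat] at h1
    have h2 : a 1 * (h - ε / (a 1 + 1)) ≤ a 1 * q := by gcongr
    have h3 : a 1 * (ε / (a 1 + 1)) < ε := by
      rw [← mul_div_assoc, div_lt_iff₀ (by positivity)]
      nlinarith
    linarith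

/-- The functional equation behind the characterization of the normal law. Let `ψ` be even and let
`r_μ(s) = ψ(s - μ) - ψ(s)`. If `r_μ(s) + r_μ(t)` is, off a countable symmetric set, a nondecreasing
function of `s + t` for every `μ > 0`, then `ψ` is quadratic off that set.

Indeed the increment `A μ h = r_μ(s + h) - r_μ(s)` does not depend on the generic base point `s`.
It is additive in `h` and nonnegative for `h ≥ 0`, and symmetric in `μ` and `h` because `ψ` is
even; hence `A μ h = A 1 1 * μ * h`. Evaluating it at an `h` which moves `s` to `μ - s` gives
`ψ s - ψ (s - μ)`. -/
theorem exists_quadratic_of_increments {ψ : ℝ → ℝ} {D : Set ℝ} (hD : D.Countable)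
    (hDneg : ∀ x, -x ∈ D → x ∈ D) (heven : ∀ x, ψ (-x) = ψ x)
    (hψ : ∀ μ, 0 < μ → ∀ s t s' t' : ℝ, s ∉ D → t ∉ D → s' ∉ D → t' ∉ D →
      s - μ ∉ D → t - μ ∉ D → s' - μ ∉ D → t' - μ ∉ D → s' + t' ≤ s + t →
      (ψ (s' - μ) - ψ s') + (ψ (t' - μ) - ψ t') ≤ (ψ (s - μ) - ψ s) + (ψ (t - μ) - ψ t)) :
    ∃ κ c : ℝ, ∀ t ∉ D, ψ t = c - κ * t ^ 2 := by
  classical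
  have hneg : ∀ x, x ∉ D → -x ∉ D := fun x hx h => hx (hDneg x h)
  have hex : ∀ μ h : ℝ, ∃ a : ℝ, 0 < μ → ∀ s, s ∉ D → s - μ ∉ D → s + h ∉ D →
      s + h - μ ∉ D → (ψ (s + h - μ) - ψ (s + h)) - (ψ (s - μ) - ψ s) = a := by
    intro μ h
    obtain ⟨t, ht⟩ := hD.exists_forall_add_notMem {0, -μ, h, h - μ}
    simp only [Finset.mem_insert, Finset.mem_singleton, forall_eq_or_imp, forall_eq, add_zero,
      ← sub_eq_add_neg, ← add_sub_assoc] at ht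
    obtain ⟨t1, t2, t3, t4⟩ := ht
    refine ⟨(ψ (t + h - μ) - ψ (t + h)) - (ψ (t - μ) - ψ t), fun hμ s s1 s2 s3 s4 => ?_⟩
    have h1 := hψ μ hμ (s + h) t s (t + h) s3 t1 s1 t3 s4 t2 s2 t4 (by linarith)
    have h2 := hψ μ hμ s (t + h) (s + h) t s1 t3 s3 t1 s2 t4 s4 t2 (by linarith)
    linarith
  choose A hA using hex
  have hadd : ∀ μ, 0 < μ → ∀ h k, A μ (h + k) = A μ h + A μ k := by
    intro μ hμ h k
    obtain ⟨t, ht⟩ := hD.exists_forall_add_notMem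
      {0, -μ, h, h - μ, h + k, h + k - μ}
    simp only [Finset.mem_insert, Finset.mem_singleton, forall_eq_or_imp, forall_eq, add_zero,
      ← sub_eq_add_neg, ← add_sub_assoc, ← add_assoc] at ht
    obtain ⟨t1, t2, t3, t4, t5, t6⟩ := ht
    have h1 := hA μ (h + k) hμ t t1 t2 (by rwa [← add_assoc]) (by rwa [← add_assoc])
    have h2 := hA μ h hμ t t1 t2 t3 t4
    have h3 := hA μ k hμ (t + h) t3 t4 t5 t6
    rw [← add_assoc] at h1
    linarith
  have hnn : ∀ μ, 0 < μ → ∀ h, 0 ≤ h → 0 ≤ A μ h := by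
    intro μ hμ h hh
    obtain ⟨t, ht⟩ := hD.exists_forall_add_notMem {0, -μ, h, h - μ}
    simp only [Finset.mem_insert, Finset.mem_singleton, forall_eq_or_imp, forall_eq, add_zero,
      ← sub_eq_add_neg, ← add_sub_assoc] at ht
    obtain ⟨t1, t2, t3, t4⟩ := ht
    have h1 := hA μ h hμ t t1 t2 t3 t4
    have h2 := hψ μ hμ (t + h) t t t t3 t1 t1 t1 t4 t2 t2 t2 (by linarith)
    linarith
  have hsymm : ∀ μ h, 0 < μ → 0 < h → A μ h = A h μ := by
    intro μ h hμ hh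
    obtain ⟨t, ht⟩ := hD.exists_forall_add_notMem {0, -μ, h, h - μ}
    simp only [Finset.mem_insert, Finset.mem_singleton, forall_eq_or_imp, forall_eq, add_zero,
      ← sub_eq_add_neg, ← add_sub_assoc] at ht
    obtain ⟨t1, t2, t3, t4⟩ := ht
    have h1 := hA μ h hμ t t1 t2 t3 t4
    -- reflecting the base point exchanges the roles of the shift and of the increment
    have e2 : -t - h = -(t + h) := by ring
    have e3 : -t + μ = -(t - μ) := by ring
    have e4 : -t + μ - h = -(t + h - μ) := by ring
    have h2 := hA h μ hh (-t) (hneg _ t1) (e2 ▸ hneg _ t3) (e3 ▸ hneg _ t2) (e4 ▸ hneg _ t4)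
    rw [e4, e3, e2, heven, heven, heven, heven] at h2
    linarith
  have hbil : ∀ μ h, 0 < μ → A μ h = A 1 1 * μ * h := by
    intro μ h hμ
    rw [eq_mul_of_additive_of_nonneg (hadd μ hμ) (hnn μ hμ) h, hsymm μ 1 hμ one_pos,
      eq_mul_of_additive_of_nonneg (hadd 1 one_pos) (hnn 1 one_pos) μ]
  have hlt : ∀ s t, t < s → s ∉ D → t ∉ D →
      ψ s + A 1 1 / 2 * s ^ 2 = ψ t + A 1 1 / 2 * t ^ 2 := by
    intro s t hts hs ht
    have hμ : 0 < s - t := sub_pos.2 hts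
    have e0 : s - (s - t) = t := by ring
    have e1 : s + (-t - s) = -t := by ring
    have e2 : -t - (s - t) = -s := by ring
    -- the increment `-t - s` moves the pair `(s, t)` to `(-t, -s)`
    have h1 := hA (s - t) (-t - s) hμ s hs (by rwa [e0])
      (by rw [e1]; exact hneg _ ht) (by rw [e1, e2]; exact hneg _ hs)
    rw [e0, e1, e2, heven, heven, hbil _ _ hμ] at h1
    linarith
  obtain ⟨t, ht⟩ := hD.exists_forall_add_notMem {0}
  simp only [Finset.mem_singleton, forall_eq, add_zero] at ht
  refine ⟨A 1 1 / 2, ψ t + A 1 1 / 2 * t ^ 2, fun s hs => ?_⟩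
  rcases lt_trichotomy s t with h | h | h
  · linarith [hlt t s h ht hs]
  · subst h; ring
  · linarith [hlt s t h hs ht]

/-! ### Densities with a quadratic logarithm -/

/-- A probability density which is the exponential of an even quadratic polynomial is a centred
Gaussian density; integrability forces the coefficient of `x ^ 2` to be negative. -/
theorem gaussian_of_quadratic_log {f : ℝ → ℝ} {κ c : ℝ}
    (hf : f =ᵐ[volume] fun x => Real.exp (c - κ * x ^ 2))
    (hone : volume.withDensity (fun x => ENNReal.ofReal (f x)) Set.univ = 1) :
    ∃ v : ℝ≥0, v ≠ 0 ∧ f =ᵐ[volume] gaussianPDFReal 0 v := by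
  have hlint : ∫⁻ x, ENNReal.ofReal (Real.exp (c - κ * x ^ 2)) = 1 := by
    rw [← hone, withDensity_apply _ MeasurableSet.univ, Measure.restrict_univ]
    exact lintegral_congr_ae (hf.mono fun x hx => by simp only [hx])
  have hκ : 0 < κ := by
    by_contra hκ
    have hle : ∫⁻ _ : ℝ, ENNReal.ofReal (Real.exp c) ≤ 1 := by
      rw [← hlint]
      refine lintegral_mono fun x => ENNReal.ofReal_le_ofReal (Real.exp_le_exp.2 ?_)
      nlinarith [sq_nonneg x]
    rw [lintegral_const, Real.volume_univ, ENNReal.mul_top (by simp [Real.exp_pos])] at hle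
    simp at hle
  set v : ℝ≥0 := ⟨1 / (2 * κ), by positivity⟩ with hv
  have hvr : (v : ℝ) = 1 / (2 * κ) := rfl
  have hv0 : v ≠ 0 := by
    rw [← NNReal.coe_ne_zero, hvr]
    positivity
  refine ⟨v, hv0, ?_⟩
  set K : ℝ := Real.exp c * Real.sqrt (2 * Real.pi * v) with hK
  have hvpos : (0 : ℝ) < v := by rw [hvr]; positivity
  have hKpos : 0 ≤ K := by positivity
  have heq : ∀ x, Real.exp (c - κ * x ^ 2) = K * gaussianPDFReal 0 v x := by
    intro x
    have hs : Real.sqrt (2 * Real.pi * v) ≠ 0 := by positivity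
    rw [gaussianPDFReal, hK, mul_assoc, mul_inv_cancel_left₀ hs, ← Real.exp_add, hvr]
    congr 1
    field_simp
    ring
  have hK1 : K = 1 := by
    simp_rw [heq, ENNReal.ofReal_mul hKpos] at hlint
    rw [lintegral_const_mul _ (by fun_prop), lintegral_gaussianPDFReal_eq_one 0 hv0, mul_one]
      at hlint
    exact ENNReal.ofReal_eq_one.1 hlint
  filter_upwards [hf] with x hx
  rw [hx, heq, hK1, one_mul]

/-! ### Monotonicity of the likelihood ratio of a most powerful mean -/

open Filter Topology in
/-- The symmetric derivative of a finite measure at a continuity point of its density. -/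
theorem tendsto_measureReal_Ioc_div {f : ℝ → ℝ} (hfm : Measurable f) (hf0 : ∀ x, 0 ≤ f x)
    {ρ : Measure ℝ} [IsFiniteMeasure ρ]
    (hρ : ρ = volume.withDensity fun x => ENNReal.ofReal (f x)) {x : ℝ} (hx : ContinuousAt f x) :
    Tendsto (fun δ => ρ.real (Set.Ioc (x - δ) (x + δ)) / (2 * δ)) (𝓝[>] 0) (𝓝 (f x)) := by
  have hint : Integrable f := by
    refine ⟨hfm.aestronglyMeasurable, ?_⟩
    rw [hasFiniteIntegral_iff_ofReal (Eventually.of_forall hf0)]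
    have := measure_lt_top ρ Set.univ
    rwa [hρ, withDensity_apply _ MeasurableSet.univ, Measure.restrict_univ] at this
  have hval : ∀ δ > 0, ρ.real (Set.Ioc (x - δ) (x + δ))
      = (∫ t in x..(x + δ), f t) - ∫ t in x..(x - δ), f t := by
    intro δ hδ
    rw [intervalIntegral.integral_interval_sub_left hint.intervalIntegrable
      hint.intervalIntegrable, intervalIntegral.integral_of_le (by linarith), Measure.real, hρ,
      withDensity_apply _ measurableSet_Ioc,
      integral_eq_lintegral_of_nonneg_ae (Eventually.of_forall hf0) hfm.aestronglyMeasurable]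
  have hderiv : HasDerivAt (fun y => ∫ t in x..y, f t) (f x) x :=
    intervalIntegral.integral_hasDerivAt_right hint.intervalIntegrable
      (hfm.stronglyMeasurable.stronglyMeasurableAtFilter) hx
  have h1 : HasDerivAt (fun δ => ∫ t in x..(x + δ), f t) (f x) 0 := by
    have := HasDerivAt.comp_const_add x 0 (by simpa using hderiv)
    simpa using this
  have h2 : HasDerivAt (fun δ => ∫ t in x..(x - δ), f t) (-f x) 0 := by
    have := HasDerivAt.comp_const_sub x 0 (by simpa using hderiv)
    simpa using this
  have h3 := (hasDerivAt_iff_tendsto_slope_zero.1 (h1.sub h2)).mono_left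
    (nhdsGT_le_nhdsNE (0 : ℝ))
  have h4 := h3.div_const 2
  rw [sub_neg_eq_add, add_self_div_two] at h4
  refine h4.congr' ?_
  filter_upwards [self_mem_nhdsWithin] with δ hδ
  rw [hval δ hδ]
  simp
  field_simp

/-- The exchange argument for necessity in the Neyman–Pearson lemma: if `A` lies in the rejection
region of a most powerful test and `B` in its acceptance region, then the likelihood ratio of `A` is
at least that of `B`. Otherwise, moving a little of the size of the test from `A` to `B` would
increase its power. -/
theorem IsMostPowerful.measureReal_mul_le {Ω 𝕏 : Type*} [MeasurableSpace Ω] [MeasurableSpace 𝕏]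
    {P₀ P₁ : Measure Ω} [IsProbabilityMeasure P₀] [IsProbabilityMeasure P₁]
    {D : Ω → 𝕏} (hD : Measurable D) {τ : 𝕏 → ℝ} (hτ : Measurable τ)
    (h : IsMostPowerful P₀ P₁ D fun ω => τ (D ω)) {A B : Set 𝕏} (hA : MeasurableSet A)
    (hB : MeasurableSet B) {C : ℝ} (hAC : ∀ x ∈ A, C < τ x) (hBC : ∀ x ∈ B, τ x ≤ C) :
    P₀.real (D ⁻¹' A) * P₁.real (D ⁻¹' B) ≤ P₀.real (D ⁻¹' B) * P₁.real (D ⁻¹' A) := by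
  set a := P₀.real (D ⁻¹' B) with ha
  set b := P₀.real (D ⁻¹' A) with hb
  have ha0 : 0 ≤ a := measureReal_nonneg
  have hb0 : 0 ≤ b := measureReal_nonneg
  have ha1 : a ≤ 1 := measureReal_le_one
  have hb1 : b ≤ 1 := measureReal_le_one
  set R : Set 𝕏 := {x | C < τ x}
  have hR : MeasurableSet R := measurableSet_lt measurable_const hτ
  -- shift mass `a * P₀(A) = b * P₀(B)` of the rejection probability from `A` to `B`
  set φ : 𝕏 → ℝ := fun x => R.indicator (fun _ => 1) x - A.indicator (fun _ => a) x
    + B.indicator (fun _ => b) x with hφ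
  have hint : ∀ P : Measure Ω, IsProbabilityMeasure P → ∫ ω, φ (D ω) ∂P
      = P.real {ω | C < τ (D ω)} - a * P.real (D ⁻¹' A) + b * P.real (D ⁻¹' B) := by
    intro P hP
    have hi : ∀ (S : Set 𝕏) (r : ℝ), MeasurableSet S →
        Integrable (fun ω => S.indicator (fun _ => r) (D ω)) P ∧
          ∫ ω, S.indicator (fun _ => r) (D ω) ∂P = r * P.real (D ⁻¹' S) := by
      intro S r hS
      have e : (fun ω => S.indicator (fun _ => r) (D ω)) = (D ⁻¹' S).indicator fun _ => r := rfl
      rw [e, integral_indicator_const r (hD hS), smul_eq_mul, mul_comm]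
      exact ⟨(integrable_const r).indicator (hD hS), rfl⟩
    have hsub : Integrable (fun ω => R.indicator (fun _ => (1 : ℝ)) (D ω)
        - A.indicator (fun _ => a) (D ω)) P := (hi R 1 hR).1.sub (hi A a hA).1
    simp only [hφ]
    rw [integral_add hsub (hi B b hB).1, integral_sub (hi R 1 hR).1 (hi A a hA).1, (hi R 1 hR).2,
      (hi A a hA).2, (hi B b hB).2,
      one_mul]
    rfl
  have hφ01 : ∀ x, 0 ≤ φ x ∧ φ x ≤ 1 := by
    intro x
    by_cases hx : C < τ x
    · have h1 : x ∈ R := hx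
      have h2 : x ∉ B := fun hB => absurd (hBC x hB) (not_le.2 hx)
      by_cases h3 : x ∈ A <;> simp [hφ, h1, h2, h3, ha0, ha1]
    · have h1 : x ∉ R := hx
      have h2 : x ∉ A := fun hA => hx (hAC x hA)
      by_cases h3 : x ∈ B <;> simp [hφ, h1, h2, h3, hb0, hb1]
  have hφm : Measurable φ :=
    ((measurable_const.indicator hR).sub (measurable_const.indicator hA)).add
      (measurable_const.indicator hB)
  have key := h C φ hφm hφ01
  rw [hint P₀ inferInstance, hint P₁ inferInstance] at key
  have := key (by rw [← ha, ← hb]; linarith)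
  linarith

open Filter Topology in
/-- If the standardized mean is most powerful, then the likelihood ratio of the sample is a
nondecreasing function of the sum of the observations, at points all of whose coordinates are
continuity points of the densities. This is the exchange inequality for boxes which shrink to `x`
and to `y`. -/
theorem prod_density_mul_le {Ω : Type*} [MeasurableSpace Ω] {P₀ P₁ : Measure Ω}
    [IsProbabilityMeasure P₀] [IsProbabilityMeasure P₁] {n : ℕ}
    {X : Fin n → Ω → ℝ} (hX : ∀ i, Measurable (X i)) (h₀ : iIndepFun X P₀) (h₁ : iIndepFun X P₁)
    {f₀ f₁ : ℝ → ℝ} (hfm₀ : Measurable f₀) (hfm₁ : Measurable f₁) (hf₀ : ∀ x, 0 ≤ f₀ x)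
    (hf₁ : ∀ x, 0 ≤ f₁ x)
    (hlaw₀ : ∀ i, P₀.map (X i) = volume.withDensity fun x => ENNReal.ofReal (f₀ x))
    (hlaw₁ : ∀ i, P₁.map (X i) = volume.withDensity fun x => ENNReal.ofReal (f₁ x))
    {σ : ℝ} (hσ : 0 < σ)
    (hMP : IsMostPowerful P₀ P₁ (fun ω i => X i ω)
      (fun ω => Real.sqrt n * sampleMean X ω / σ))
    {x y : Fin n → ℝ} (hxy : ∑ i, y i < ∑ i, x i)
    (hx₀ : ∀ i, ContinuousAt f₀ (x i)) (hx₁ : ∀ i, ContinuousAt f₁ (x i))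
    (hy₀ : ∀ i, ContinuousAt f₀ (y i)) (hy₁ : ∀ i, ContinuousAt f₁ (y i)) :
    (∏ i, f₀ (x i)) * ∏ i, f₁ (y i) ≤ (∏ i, f₀ (y i)) * ∏ i, f₁ (x i) := by
  have hn : 0 < n := by
    rcases Nat.eq_zero_or_pos n with rfl | h
    · simp at hxy
    · exact h
  have hnpos : (0 : ℝ) < n := by exact_mod_cast hn
  have hD : Measurable (fun ω i => X i ω) := measurable_pi_lambda _ hX
  set box : (Fin n → ℝ) → ℝ → Set (Fin n → ℝ) := fun z δ =>
    Set.univ.pi fun i => Set.Ioc (z i - δ) (z i + δ) with hbox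
  have hboxm : ∀ z δ, MeasurableSet (box z δ) := fun z δ =>
    MeasurableSet.univ_pi fun i => measurableSet_Ioc
  have hlim : ∀ (P : Measure Ω) [IsProbabilityMeasure P] (g : ℝ → ℝ) (z : Fin n → ℝ),
      iIndepFun X P → Measurable g → (∀ x, 0 ≤ g x) →
      (∀ i, P.map (X i) = volume.withDensity fun x => ENNReal.ofReal (g x)) →
      (∀ i, ContinuousAt g (z i)) →
      Tendsto (fun δ => P.real ((fun ω i => X i ω) ⁻¹' box z δ) / (2 * δ) ^ n) (𝓝[>] 0)
        (𝓝 (∏ i, g (z i))) := by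
    intro P _ g z hind hgm hg0 hlaw hz
    have h := tendsto_finsetProd Finset.univ fun i _ =>
      haveI := Measure.isProbabilityMeasure_map (μ := P) (hX i).aemeasurable
      tendsto_measureReal_Ioc_div hgm hg0 (hlaw i) (hz i)
    refine h.congr fun δ => ?_
    rw [Finset.prod_div_distrib, Finset.prod_const, Finset.card_univ, Fintype.card_fin]
    congr 1
    have hpre : (fun ω i => X i ω) ⁻¹' box z δ
        = ⋂ i, X i ⁻¹' Set.Ioc (z i - δ) (z i + δ) := by
      ext ω
      simp [hbox]
    rw [hpre, Measure.real, hind.meas_iInter fun i => ⟨_, measurableSet_Ioc, rfl⟩,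
      ENNReal.toReal_prod]
    exact Finset.prod_congr rfl fun i _ => map_measureReal_apply (hX i) measurableSet_Ioc
  have hineq : ∀ᶠ δ in 𝓝[>] (0 : ℝ),
      P₀.real ((fun ω i => X i ω) ⁻¹' box x δ) * P₁.real ((fun ω i => X i ω) ⁻¹' box y δ)
      ≤ P₀.real ((fun ω i => X i ω) ⁻¹' box y δ) * P₁.real ((fun ω i => X i ω) ⁻¹' box x δ) := by
    -- boxes so small that a threshold `M` halfway between the two sums separates them
    set η := ((∑ i, x i) - ∑ i, y i) / (2 * n) with hη
    have hηpos : 0 < η := div_pos (sub_pos.2 hxy) (by positivity)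
    filter_upwards [Ioo_mem_nhdsGT hηpos] with δ hδ
    set M := ((∑ i, x i) + ∑ i, y i) / 2 with hM
    have hnη : (n : ℝ) * η = ((∑ i, x i) - ∑ i, y i) / 2 := by
      rw [hη]; field_simp
    have hM' : M / (σ * Real.sqrt n) * σ * Real.sqrt n = M := by
      have : Real.sqrt n ≠ 0 := (Real.sqrt_pos.2 hnpos).ne'
      field_simp
    refine hMP.measureReal_mul_le (C := M / (σ * Real.sqrt n))
      (τ := fun z => Real.sqrt n * ((∑ i, z i) / n) / σ) hD (by fun_prop)
      (hboxm x δ) (hboxm y δ) ?_ ?_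
    · intro z hz
      rw [lt_standardized_iff hn hσ, hM']
      have : ∑ i, (x i - η) < ∑ i, z i :=
        Finset.sum_lt_sum_of_nonempty ⟨⟨0, hn⟩, Finset.mem_univ _⟩ fun i _ => by
          have := (hz i trivial).1
          linarith [hδ.2]
      rw [Finset.sum_sub_distrib] at this
      simp only [Finset.sum_const, Finset.card_univ, Fintype.card_fin, nsmul_eq_mul] at this
      linarith
    · intro z hz
      rw [← not_lt, lt_standardized_iff hn hσ, hM', not_lt]
      have : ∑ i, z i ≤ ∑ i, (y i + η) :=
        Finset.sum_le_sum fun i _ => by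
          have := (hz i trivial).2
          linarith [hδ.2]
      rw [Finset.sum_add_distrib] at this
      simp only [Finset.sum_const, Finset.card_univ, Fintype.card_fin, nsmul_eq_mul] at this
      linarith
  refine le_of_tendsto_of_tendsto
    ((hlim P₀ f₀ x h₀ hfm₀ hf₀ hlaw₀ hx₀).mul (hlim P₁ f₁ y h₁ hfm₁ hf₁ hlaw₁ hy₁))
    ((hlim P₀ f₀ y h₀ hfm₀ hf₀ hlaw₀ hy₀).mul (hlim P₁ f₁ x h₁ hfm₁ hf₁ hlaw₁ hx₁)) ?_
  filter_upwards [hineq, self_mem_nhdsWithin] with δ hδ hδ0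
  have h0 : (0 : ℝ) < δ := hδ0
  rw [div_mul_div_comm, div_mul_div_comm]
  gcongr

/-! ### Symmetric unimodal densities with a most powerful mean -/

theorem IsSymmetricUnimodalDensity.even {f : ℝ → ℝ} (hf : IsSymmetricUnimodalDensity f 0) (x : ℝ) :
    f (-x) = f x := by
  simpa using (hf.symmetric x).symm

theorem IsSymmetricUnimodalDensity.countable_not_continuousAt {f : ℝ → ℝ} {m : ℝ}
    (hf : IsSymmetricUnimodalDensity f m) : {x | ¬ ContinuousAt f x}.Countable := by
  refine (((Set.countable_singleton m).union
    hf.monotoneOn.countable_not_continuousWithinAt).union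
    hf.antitoneOn.countable_not_continuousWithinAt).mono fun x hx => ?_
  rcases lt_trichotomy x m with h | h | h
  · exact Or.inl (Or.inr ⟨h, fun hc => hx (hc.continuousAt (Iio_mem_nhds h))⟩)
  · exact Or.inl (Or.inl h)
  · exact Or.inr ⟨h, fun hc => hx (hc.continuousAt (Ioi_mem_nhds h))⟩

/-- If one and the same statistic is most powerful against all shifts, the density vanishes nowhere
off its centre. If it vanished at `a > 0`, the test which rejects when one observation is at least
`a` would have size `0`, and power `1` against the shift `2 * a`; every test `T > C` would then have
power `1`, which is absurd for `C → ∞`. -/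
theorem density_pos_of_isMostPowerful {Ω : Type*} [MeasurableSpace Ω] {P : ℝ → Measure Ω}
    [∀ μ, IsProbabilityMeasure (P μ)] {n : ℕ} (hn : 0 < n) {X : Fin n → Ω → ℝ}
    (hX : ∀ i, Measurable (X i)) {f : ℝ → ℝ} (hf : IsSymmetricUnimodalDensity f 0)
    (hlaw : ∀ μ i, (P μ).map (X i) = volume.withDensity (fun x => ENNReal.ofReal (f (x - μ))))
    {T : Ω → ℝ} (hT : Measurable T)
    (hMP : ∀ μ : ℝ, 0 < μ → IsMostPowerful (P 0) (P μ) (fun ω i => X i ω) T)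
    {x : ℝ} (hx : x ≠ 0) : 0 < f x := by
  by_contra hfx
  set a := |x| with ha
  have hapos : 0 < a := abs_pos.2 hx
  have hfa : f a = 0 := by
    have h1 : f a = f x := by
      rcases abs_cases x with ⟨h, _⟩ | ⟨h, _⟩
      · rw [ha, h]
      · rw [ha, h, hf.even]
    rw [h1]
    exact le_antisymm (not_lt.1 hfx) (hf.nonneg x)
  have hge : ∀ t, a ≤ t → f t = 0 := fun t ht =>
    le_antisymm (hfa ▸ hf.antitoneOn hapos (hapos.trans_le ht) ht) (hf.nonneg t)
  set i : Fin n := ⟨0, hn⟩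
  set S : Set (Fin n → ℝ) := {z | a ≤ z i} with hS
  have hSm : MeasurableSet S := measurableSet_le measurable_const (measurable_pi_apply i)
  have hD : Measurable (fun ω i => X i ω) := measurable_pi_lambda _ hX
  have hpow : ∀ μ, ∫ ω, S.indicator (fun _ => (1 : ℝ)) (fun i => X i ω) ∂(P μ)
      = (P μ).real {ω | a ≤ X i ω} := by
    intro μ
    exact integral_indicator_one (μ := P μ) (hD hSm)
  have hnull : (P 0) {ω | a ≤ X i ω} = 0 := by
    have h : (P 0).map (X i) (Set.Ici a) = 0 := by
      rw [hlaw, withDensity_apply _ measurableSet_Ici]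
      refine setLIntegral_eq_zero measurableSet_Ici fun t ht => ?_
      simp [hge t ht]
    rwa [Measure.map_apply (hX i) measurableSet_Ici] at h
  -- the support of the density shifted by `2 * a` lies to the right of `a`
  have hfull : (P (2 * a)) {ω | a ≤ X i ω}ᶜ = 0 := by
    have h : (P (2 * a)).map (X i) (Set.Ici a)ᶜ = 0 := by
      rw [hlaw, withDensity_apply _ measurableSet_Ici.compl]
      refine setLIntegral_eq_zero measurableSet_Ici.compl fun t ht => ?_
      have ht' : t < a := not_le.1 ht
      have : f (t - 2 * a) = 0 := by
        rw [← hf.even]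
        exact hge _ (by linarith)
      simp [this]
    rwa [Measure.map_apply (hX i) measurableSet_Ici.compl] at h
  have hone : ∀ C : ℝ, (P (2 * a)).real {ω | C < T ω} = 1 := by
    intro C
    refine le_antisymm measureReal_le_one ?_
    have h := hMP (2 * a) (by positivity) C (S.indicator fun _ => 1)
      (measurable_const.indicator hSm)
      (fun z => ⟨Set.indicator_nonneg (fun _ _ => zero_le_one) z,
        Set.indicator_le_self' (fun _ _ => zero_le_one) z⟩)
    rw [hpow, hpow] at h
    have h0 : (P 0).real {ω | a ≤ X i ω} = 0 := by simp [Measure.real, hnull]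
    have h1 : (P (2 * a)).real {ω | a ≤ X i ω} = 1 := by
      rw [Measure.real, (prob_compl_eq_zero_iff (measurableSet_le measurable_const (hX i))).1 hfull,
        ENNReal.toReal_one]
    rw [h0, h1] at h
    exact h measureReal_nonneg
  have hall : ∀ᵐ ω ∂(P (2 * a)), ∀ k : ℕ, (k : ℝ) < T ω := by
    refine ae_all_iff.2 fun k => ?_
    have hm : MeasurableSet {ω | (k : ℝ) < T ω} := measurableSet_lt measurable_const hT
    refine (mem_ae_iff_prob_eq_one hm).2 ?_
    rw [← ofReal_measureReal, hone, ENNReal.ofReal_one]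
  obtain ⟨ω, hω⟩ := hall.exists
  obtain ⟨k, hk⟩ := exists_nat_gt (T ω)
  exact absurd (hω k) (not_lt.2 hk.le)

open Filter Topology in
/-- Two observations suffice to exploit the monotonicity of the likelihood ratio in the sum: all
other coordinates are frozen at a common generic value `c`. Equality of the two sums, which the
strict comparison leaves out, is reached by letting `s` be approached from the right. -/
theorem log_density_increments_le {Ω : Type*} [MeasurableSpace Ω] {P₀ P₁ : Measure Ω}
    [IsProbabilityMeasure P₀] [IsProbabilityMeasure P₁] {n : ℕ} (hn : 2 ≤ n)
    {X : Fin n → Ω → ℝ} (hX : ∀ i, Measurable (X i)) (h₀ : iIndepFun X P₀) (h₁ : iIndepFun X P₁)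
    {f : ℝ → ℝ} (hfm : Measurable f) (hf0 : ∀ x, 0 ≤ f x) {μ : ℝ}
    (hlaw₀ : ∀ i, P₀.map (X i) = volume.withDensity fun x => ENNReal.ofReal (f x))
    (hlaw₁ : ∀ i, P₁.map (X i) = volume.withDensity fun x => ENNReal.ofReal (f (x - μ)))
    {σ : ℝ} (hσ : 0 < σ)
    (hMP : IsMostPowerful P₀ P₁ (fun ω i => X i ω)
      (fun ω => Real.sqrt n * sampleMean X ω / σ))
    {D : Set ℝ} (hD : D.Countable) (hcont : ∀ x ∉ D, ContinuousAt f x) (hpos : ∀ x ∉ D, 0 < f x)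
    {s t s' t' : ℝ} (hs : s ∉ D) (ht : t ∉ D) (hs' : s' ∉ D) (ht' : t' ∉ D)
    (hsμ : s - μ ∉ D) (htμ : t - μ ∉ D) (hsμ' : s' - μ ∉ D) (htμ' : t' - μ ∉ D)
    (hle : s' + t' ≤ s + t) :
    (Real.log (f (s' - μ)) - Real.log (f s')) + (Real.log (f (t' - μ)) - Real.log (f t'))
      ≤ (Real.log (f (s - μ)) - Real.log (f s)) + (Real.log (f (t - μ)) - Real.log (f t)) := by
  obtain ⟨k, rfl⟩ : ∃ k, n = k + 2 := ⟨n - 2, by omega⟩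
  obtain ⟨c, hc⟩ := hD.exists_forall_add_notMem {0, -μ}
  simp only [Finset.mem_insert, Finset.mem_singleton, forall_eq_or_imp, forall_eq, add_zero,
    ← sub_eq_add_neg] at hc
  obtain ⟨hc, hcμ⟩ := hc
  have hcont' : ∀ x, x - μ ∉ D → ContinuousAt (fun x => f (x - μ)) x := fun x hx =>
    ContinuousAt.comp (f := fun x => x - μ) (hcont _ hx) (by fun_prop)
  have hstrict : ∀ u, u ∉ D → u - μ ∉ D → s < u →
      (Real.log (f (s' - μ)) - Real.log (f s')) + (Real.log (f (t' - μ)) - Real.log (f t'))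
      ≤ (Real.log (f (u - μ)) - Real.log (f u)) + (Real.log (f (t - μ)) - Real.log (f t)) := by
    intro u hu huμ hsu
    have h := prod_density_mul_le hX h₀ h₁ hfm (f₁ := fun x => f (x - μ)) (by fun_prop) hf0
      (fun x => hf0 _) hlaw₀ hlaw₁ hσ hMP
      (x := Fin.cons u (Fin.cons t fun _ => c)) (y := Fin.cons s' (Fin.cons t' fun _ => c))
      (by simp only [Fin.sum_univ_succ, Fin.cons_zero, Fin.cons_succ]; linarith)
      (by
        refine Fin.cases (hcont u hu) (Fin.cases (hcont t ht) fun _ => hcont c hc))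
      (by
        refine Fin.cases (hcont' u huμ) (Fin.cases (hcont' t htμ) fun _ => hcont' c hcμ))
      (by
        refine Fin.cases (hcont s' hs') (Fin.cases (hcont t' ht') fun _ => hcont c hc))
      (by
        refine Fin.cases (hcont' s' hsμ') (Fin.cases (hcont' t' htμ') fun _ => hcont' c hcμ))
    simp only [Fin.prod_univ_succ, Fin.cons_zero, Fin.cons_succ, Finset.prod_const] at h
    have hK := pow_pos (hpos c hc) (Finset.univ : Finset (Fin k)).card
    have hKμ := pow_pos (hpos _ hcμ) (Finset.univ : Finset (Fin k)).card
    have p1 := hpos _ hu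
    have p2 := hpos _ ht
    have p3 := hpos _ hs'
    have p4 := hpos _ ht'
    have p5 := hpos _ huμ
    have p6 := hpos _ htμ
    have p7 := hpos _ hsμ'
    have p8 := hpos _ htμ'
    have h2 := Real.log_le_log (by positivity) h
    rw [Real.log_mul (by positivity) (by positivity), Real.log_mul (by positivity) (by positivity),
      Real.log_mul (by positivity) (by positivity), Real.log_mul (by positivity) (by positivity),
      Real.log_mul (by positivity) (by positivity), Real.log_mul (by positivity) (by positivity),
      Real.log_mul (by positivity) (by positivity), Real.log_mul (by positivity) (by positivity),
      Real.log_mul (by positivity) (by positivity), Real.log_mul (by positivity) (by positivity)]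
      at h2
    linarith
  set E : Set ℝ := Set.Ioi s ∩ (D ∪ (fun u => u - μ) ⁻¹' D)ᶜ with hE
  have hdense : Dense (D ∪ (fun u => u - μ) ⁻¹' D)ᶜ :=
    (hD.union (hD.preimage (sub_left_injective (b := μ)))).dense_compl ℝ
  have hmem : s ∈ closure E := by
    have h1 : closure (Set.Ioi s) ⊆ closure E :=
      closure_minimal (hdense.open_subset_closure_inter isOpen_Ioi) isClosed_closure
    exact h1 (by rw [closure_Ioi]; exact Set.self_mem_Ici)
  have : (𝓝[E] s).NeBot := mem_closure_iff_nhdsWithin_neBot.1 hmem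
  have hlim : Tendsto (fun u => (Real.log (f (u - μ)) - Real.log (f u))
      + (Real.log (f (t - μ)) - Real.log (f t))) (𝓝[E] s)
      (𝓝 ((Real.log (f (s - μ)) - Real.log (f s)) + (Real.log (f (t - μ)) - Real.log (f t)))) := by
    have c1 : ContinuousAt (fun u => Real.log (f (u - μ))) s :=
      (hcont' s hsμ).log (hpos _ hsμ).ne'
    have c2 : ContinuousAt (fun u => Real.log (f u)) s := (hcont s hs).log (hpos _ hs).ne'
    exact ((c1.sub c2).add continuousAt_const).tendsto.mono_left nhdsWithin_le_nhds
  refine ge_of_tendsto hlim ?_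
  filter_upwards [self_mem_nhdsWithin] with u hu
  exact hstrict u (fun h => hu.2 (Or.inl h)) (fun h => hu.2 (Or.inr h)) hu.1

/-! ### The characterization of the normal law -/

theorem proposition3p3 {Ω : Type*} [MeasurableSpace Ω]
    -- the model: `P μ` is the probability when the location parameter is `μ`
    (P : ℝ → Measure Ω) [∀ μ, IsProbabilityMeasure (P μ)]
    (n : ℕ) (hn : 2 ≤ n)
    -- `X 0, …, X (n - 1)` are i.i.d. with density `f (· - μ)`, symmetric and unimodal about `μ`
    (X : Fin n → Ω → ℝ) (hX : ∀ i, Measurable (X i))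
    (hindep : ∀ μ, iIndepFun X (P μ))
    (f : ℝ → ℝ) (hf : IsSymmetricUnimodalDensity f 0)
    (hlaw : ∀ μ i, (P μ).map (X i) = volume.withDensity (fun x => ENNReal.ofReal (f (x - μ))))
    -- finite second moment, variance `σ ^ 2`
    (hL2 : ∀ μ i, MemLp (X i) 2 (P μ))
    (σ : ℝ) (hσ : 0 < σ) (hvar : ∀ μ i, variance (X i) (P μ) = σ ^ 2)
    -- completeness of the sample mean under `H₀ : μ = 0` or under `H₁ : μ > 0`
    (hcomplete : IsCompleteStatistic P {0} (sampleMean X) ∨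
      IsCompleteStatistic P (Set.Ioi 0) (sampleMean X)) :
    (∀ μ i, ∃ (m : ℝ) (v : ℝ≥0), v ≠ 0 ∧ (P μ).map (X i) = gaussianReal m v) ↔
      ∀ μ : ℝ, 0 < μ →
        IsMostPowerful (P 0) (P μ) (fun ω i => X i ω)
          (fun ω => Real.sqrt n * sampleMean X ω / σ) := by
  have hn0 : 0 < n := by omega
  have hlaw0 : ∀ i, (P 0).map (X i) = volume.withDensity fun x => ENNReal.ofReal (f x) := by
    intro i
    simpa using hlaw 0 i
  constructor
  · intro hG μ hμ
    obtain ⟨m, v, hv, hm⟩ := hG 0 ⟨0, hn0⟩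
    have h0 : ∀ i, (P 0).map (X i) = gaussianReal m v := fun i => by
      rw [← hm, hlaw0, hlaw0]
    refine isMostPowerful_of_gaussian hn0 hX (hindep 0) (hindep μ) hv hμ h0 (fun i => ?_) hσ
    rw [← gaussianReal_map_add_const, ← h0 i, hlaw, hlaw, map_add_withDensity_ofReal, zero_add]
  · intro hMP
    have hT : Measurable fun ω => Real.sqrt n * sampleMean X ω / σ := by
      unfold sampleMean
      fun_prop
    -- the mode is excluded, since `f 0` is arbitrary
    set D : Set ℝ := {0} ∪ {x | ¬ ContinuousAt f x} with hDdef
    have hD : D.Countable := (Set.countable_singleton 0).union hf.countable_not_continuousAt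
    have hcont : ∀ x ∉ D, ContinuousAt f x := fun x hx =>
      not_not.1 fun h => hx (Or.inr h)
    have hpos : ∀ x ∉ D, 0 < f x := fun x hx =>
      density_pos_of_isMostPowerful hn0 hX hf hlaw hT hMP fun h => hx (Or.inl h)
    have hDneg : ∀ x, -x ∈ D → x ∈ D := by
      rintro x (hx | hx)
      · exact Or.inl (neg_eq_zero.1 hx)
      · refine Or.inr fun hc => hx ?_
        have h1 : ContinuousAt (fun y => f (-y)) (-x) :=
          ContinuousAt.comp (f := fun y => -y) (by rwa [neg_neg]) (by fun_prop)
        simpa only [hf.even] using h1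
    obtain ⟨κ, c, hquad⟩ := exists_quadratic_of_increments (ψ := fun x => Real.log (f x)) hD hDneg
      (fun x => by rw [hf.even]) fun μ hμ s t s' t' h1 h2 h3 h4 h5 h6 h7 h8 hle =>
        log_density_increments_le hn hX (hindep 0) (hindep μ) hf.measurable hf.nonneg hlaw0
          (hlaw μ) hσ (hMP μ hμ) hD hcont hpos h1 h2 h3 h4 h5 h6 h7 h8 hle
    have hae : f =ᵐ[volume] fun x => Real.exp (c - κ * x ^ 2) := by
      filter_upwards [hD.ae_notMem volume] with x hx
      rw [← hquad x hx, Real.exp_log (hpos x hx)]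
    obtain ⟨v, hv, hfv⟩ := gaussian_of_quadratic_log hae (by
      rw [← hlaw0 ⟨0, hn0⟩, Measure.map_apply (hX _) MeasurableSet.univ, Set.preimage_univ,
        measure_univ])
    intro μ i
    refine ⟨μ, v, hv, ?_⟩
    rw [hlaw, gaussianReal_of_var_ne_zero _ hv]
    refine withDensity_congr_ae ?_
    filter_upwards [(measurePreserving_sub_right volume μ).quasiMeasurePreserving.ae hfv] with x hx
    rw [hx, gaussianPDFReal_sub, zero_add, gaussianPDF]
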